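/- Let $X=(X_t)_{t\ge 0}$ be a real-valued Lévy process (started at $0$, with stationary and independent increments and almost surely càdlàg paths) on a probability space $(\Omega,\mathcal F,\mathbb P)$ such that for every $t>0$ the law of $X_t$ has no atoms. Write $X_{t-}$ for the left limit of the path at $t$ (with $X_{0-}:=X_0$) and $\Delta X_t:=X_t-X_{t-}$ for its jump. Then for every $x\in\mathbb R$, $$\mathbb P\bigl[\{t\in[0,1]:\ \Delta X_t\neq 0,\ X_{t-}=x\}=\varnothing\bigr]=1 \qquad\text{and}\qquad \mathbb P\bigl[\{t\in[0,1]:\ \Delta X_t\neq 0,\ X_{t}=x\}=\varnothing\bigr]=1 .$$ That is, each of the two complementary events is contained in a $\mathbb P$-null set. -/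

import Mathlib

open MeasureTheory ProbabilityTheory Filter Topology Set
open scoped NNReal

/-- A path `f : [0, ∞) → ℝ` is càdlàg: right-continuous everywhere, with a finite left limit
everywhere (at time `0` the left neighbourhood is empty and the second clause is void). -/
def IsCadlagPath (f : ℝ≥0 → ℝ) : Prop :=
  ∀ t : ℝ≥0, ContinuousWithinAt f (Ici t) t ∧ ∃ l : ℝ, Tendsto f (𝓝[<] t) (𝓝 l)

/-- `X` is a real-valued Lévy process under `P`: random variables `X t`, started at `0`, with
independent and stationary increments and almost surely càdlàg paths. Stochastic continuity,
which is sometimes listed too, follows from these properties. -/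
structure IsLevyProcess {Ω : Type*} [MeasurableSpace Ω] (X : ℝ≥0 → Ω → ℝ) (P : Measure Ω) :
    Prop where
  measurable : ∀ t, Measurable (X t)
  start_zero : ∀ᵐ ω ∂P, X 0 ω = 0
  indep_increments : HasIndepIncrements X P
  stationary_increments : ∀ s h : ℝ≥0,
    P.map (fun ω => X (s + h) ω - X s ω) = P.map (X h)
  cadlag : ∀ᵐ ω ∂P, IsCadlagPath (fun t => X t ω)

/-- The left limit `f (t-)` of a path. At `t = 0` it is `f 0` (there is nothing to the left). -/
noncomputable def pathLeftLim (f : ℝ≥0 → ℝ) (t : ℝ≥0) : ℝ := Function.leftLim f t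

/-- The jump `Δf t = f t - f (t-)` of a path at time `t`; there is no jump at time `0`. -/
noncomputable def pathJump (f : ℝ≥0 → ℝ) (t : ℝ≥0) : ℝ := f t - pathLeftLim f t

/-! Cut `[0,1]` into `n` equal cells. A jump larger than `ε` at `t` forces, for all large `n`, the
cell containing `t` to have an increment `Z` larger than `ε`, while its end values approach `X_{t-}`
and `X_t` (`eventually_exists_grid_cell`). Both end values have the form `Y + θ Z`, with `Y` the
left value and `θ = 0` or `1`, so one estimate serves both claims.

A fixed cell has a large increment with probability `O(1/n)` (`exists_measure_step_le`), so the
expected number of such cells stays bounded. Since `Y` and `Z` are independent, requiring also `|Y +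
θ Z - x| ≤ δ` costs a factor `1/L` once the cell starts after time `1/L`: for small `δ` the atomless
law of `X_{1/L}` gives every `δ`-ball mass at most `1/L`, and adding independent increments cannot
raise this bound. Cells starting before `1/L` are a fraction `1/L` of all cells. The total is
`O(1/L)`, with `L` arbitrary. -/

/-- A finite measure without atoms gives uniformly small mass to small balls. -/
lemma exists_closedBall_measure_le (μ : Measure ℝ) [IsFiniteMeasure μ] (hμ : ∀ y, μ {y} = 0)
    {c : ℝ≥0} (hc : 0 < c) : ∃ δ : ℝ, 0 < δ ∧ ∀ y, μ (Metric.closedBall y δ) ≤ c := by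
  -- Strips shrinking to the diagonal, which is null for `μ × μ`. A ball of mass above `c` would put
  -- a square of mass at least `c²` inside a strip.
  let D : ℕ → Set (ℝ × ℝ) := fun n => {p | dist p.1 p.2 ≤ 2 * (1 / ((n : ℝ) + 1))}
  have hDm : ∀ n, MeasurableSet (D n) := fun n =>
    (isClosed_le (by fun_prop) (by fun_prop)).measurableSet
  have hDanti : Antitone D := fun a b hab p hp => by
    have := Nat.one_div_le_one_div (α := ℝ) hab
    simp only [D, mem_ofPred_eq] at hp ⊢
    linarith
  have hdiag : (μ.prod μ) (⋂ n, D n) = 0 := by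
    rw [Measure.prod_apply (MeasurableSet.iInter hDm)]
    refine (lintegral_congr fun a => ?_).trans lintegral_zero
    refine measure_mono_null (fun b hb => ?_) (hμ a)
    have hb' : ∀ n : ℕ, dist a b ≤ 2 * (1 / ((n : ℝ) + 1)) := fun n => by
      simpa [D] using mem_iInter.1 hb n
    have hlim : Tendsto (fun n : ℕ => 2 * (1 / ((n : ℝ) + 1))) atTop (𝓝 0) := by
      simpa using tendsto_one_div_add_atTop_nhds_zero_nat.const_mul (2 : ℝ)
    have := ge_of_tendsto' hlim hb'
    exact (dist_le_zero.1 this).symm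
  have htend := tendsto_measure_iInter_atTop (μ := μ.prod μ)
    (fun n => (hDm n).nullMeasurableSet) hDanti ⟨0, measure_ne_top _ _⟩
  rw [hdiag] at htend
  have hc2 : (0 : ENNReal) < (c : ENNReal) * c := by
    have : (0 : ENNReal) < c := by exact_mod_cast hc
    exact ENNReal.mul_pos this.ne' this.ne'
  obtain ⟨n, hn⟩ := (htend.eventually (gt_mem_nhds hc2)).exists
  refine ⟨1 / ((n : ℝ) + 1), Nat.one_div_pos_of_nat, fun y => ?_⟩
  by_contra! h
  refine absurd hn (not_lt.2 ?_)
  calc (c : ENNReal) * c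
      ≤ μ (Metric.closedBall y (1 / ((n : ℝ) + 1))) * μ (Metric.closedBall y (1 / ((n : ℝ) + 1))) :=
        mul_le_mul' h.le h.le
    _ = (μ.prod μ) (Metric.closedBall y (1 / ((n : ℝ) + 1)) ×ˢ
          Metric.closedBall y (1 / ((n : ℝ) + 1))) := (Measure.prod_prod _ _).symm
    _ ≤ (μ.prod μ) (D n) := measure_mono fun p hp => by
        have h1 := Metric.mem_closedBall.1 hp.1
        have h2 := Metric.mem_closedBall'.1 hp.2
        have := dist_triangle p.1 y p.2
        simp only [D, mem_ofPred_eq]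
        linarith

/-- If every section of `S` has mass at most `q` under the law of `Y`, then, for `Z` independent
of `Y`, the event `(Y, Z) ∈ S`, `Z ∈ J` has probability at most `q * P (Z ∈ J)`. -/
lemma measure_indep_section_le {Ω : Type*} [MeasurableSpace Ω] {P : Measure Ω}
    [IsProbabilityMeasure P] {Y Z : Ω → ℝ} (hY : Measurable Y) (hZ : Measurable Z)
    (hYZ : IndepFun Y Z P) {S : Set (ℝ × ℝ)} (hS : MeasurableSet S) {J : Set ℝ}
    (hJ : MeasurableSet J) {q : ENNReal} (hq : ∀ z, P {ω | (Y ω, z) ∈ S} ≤ q) :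
    P {ω | (Y ω, Z ω) ∈ S ∧ Z ω ∈ J} ≤ q * P {ω | Z ω ∈ J} := by
  have hSJ : MeasurableSet (S ∩ Prod.snd ⁻¹' J) := hS.inter (measurable_snd hJ)
  have := Measure.isProbabilityMeasure_map (μ := P) hY.aemeasurable
  have := Measure.isProbabilityMeasure_map (μ := P) hZ.aemeasurable
  calc P {ω | (Y ω, Z ω) ∈ S ∧ Z ω ∈ J}
      = (P.map fun ω => (Y ω, Z ω)) (S ∩ Prod.snd ⁻¹' J) := by
        rw [Measure.map_apply (hY.prodMk hZ) hSJ]; rfl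
    _ = ∫⁻ z, (P.map Y) ((fun y => (y, z)) ⁻¹' (S ∩ Prod.snd ⁻¹' J)) ∂(P.map Z) := by
        rw [hYZ.map_prod_eq_prod_map_map hY.aemeasurable hZ.aemeasurable,
          Measure.prod_apply_symm hSJ]
    _ ≤ ∫⁻ z, J.indicator (fun _ => q) z ∂(P.map Z) := by
        refine lintegral_mono fun z => ?_
        by_cases hz : z ∈ J
        · rw [indicator_of_mem hz, Measure.map_apply hY (hSJ.preimage (by fun_prop))]
          exact (measure_mono fun ω hω => hω.1).trans (hq z)
        · rw [indicator_of_notMem hz, nonpos_iff_eq_zero]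
          refine measure_mono_null (fun y hy => hz hy.2) measure_empty
    _ = q * P {ω | Z ω ∈ J} := by
        rw [lintegral_indicator_const hJ, Measure.map_apply hZ hJ]; rfl

/-! ### Jumps of a càdlàg path seen on uniform grids -/

namespace IsCadlagPath

/-- Around a jump time `t` with jump larger than `ε`, the cell of a fine uniform grid that contains
`t` has an increment larger than `ε`, and its end points have values close to `f (t-)`, `f t`. -/
lemma eventually_exists_grid_cell {f : ℝ≥0 → ℝ} (hf : IsCadlagPath f) {t : ℝ≥0} (ht : t ≤ 1)
    {ε δ : ℝ} (hε : 0 < ε) (hδ : 0 < δ) (hjump : ε < |pathJump f t|) :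
    ∀ᶠ n : ℕ in atTop, ∃ k < n, ε < |f (((k + 1 : ℕ) : ℝ≥0) / n) - f ((k : ℝ≥0) / n)| ∧
      |f ((k : ℝ≥0) / n) - pathLeftLim f t| ≤ δ ∧ |f (((k + 1 : ℕ) : ℝ≥0) / n) - f t| ≤ δ := by
  have ht0 : 0 < t := by
    refine pos_iff_ne_zero.2 fun h => ?_
    have hbot : 𝓝[<] t = ⊥ := by
      rw [h, show Iio (0 : ℝ≥0) = ∅ from Iio_bot, nhdsWithin_empty]
    have : pathJump f t = 0 := by
      simp [pathJump, pathLeftLim, leftLim_eq_of_eq_bot f hbot]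
    rw [this, abs_zero] at hjump
    exact hε.not_gt hjump
  obtain ⟨hright, l, hl⟩ := hf t
  have : (𝓝[<] t).NeBot := nhdsLT_neBot_of_exists_lt ⟨0, ht0⟩
  have hleft : pathLeftLim f t = l := leftLim_eq_of_tendsto hl
  -- The ceiling makes cells open on the left and closed on the right, so `k/n < t` strictly even
  -- when `t` is a grid point; this is what yields the left limit.
  let k : ℕ → ℕ := fun n => ⌈t * n⌉₊ - 1
  have hk : ∀ n : ℕ, 0 < n → (k n : ℝ≥0) / n < t ∧ t ≤ ((k n + 1 : ℕ) : ℝ≥0) / n ∧ k n < n := by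
    intro n hn
    have hn' : (0 : ℝ≥0) < n := by exact_mod_cast hn
    have hpos : 0 < ⌈t * n⌉₊ := Nat.ceil_pos.2 (mul_pos ht0 hn')
    have hk1 : k n + 1 = ⌈t * n⌉₊ := Nat.sub_add_cancel hpos
    refine ⟨?_, ?_, ?_⟩
    · rw [div_lt_iff₀ hn', ← Nat.lt_ceil]; omega
    · rw [le_div_iff₀ hn', hk1]; exact Nat.le_ceil _
    · have : ⌈t * n⌉₊ ≤ n := Nat.ceil_le.2 (mul_le_of_le_one_left zero_le ht)
      omega
  have hinv : Tendsto (fun n : ℕ => (1 : ℝ≥0) / n) atTop (𝓝 0) := tendsto_one_div_atTop_nhds_zero_nat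
  have hcell : ∀ n : ℕ, ((k n + 1 : ℕ) : ℝ≥0) / n = (k n : ℝ≥0) / n + 1 / n := fun n => by
    rw [Nat.cast_succ, add_div]
  have hA : Tendsto (fun n => (k n : ℝ≥0) / n) atTop (𝓝[<] t) := by
    refine tendsto_nhdsWithin_iff.2 ⟨?_, ?_⟩
    · have hsub : Tendsto (fun n : ℕ => t - (1 : ℝ≥0) / n) atTop (𝓝 t) := by
        simpa using (tendsto_const_nhds (x := t)).sub hinv
      refine tendsto_of_tendsto_of_tendsto_of_le_of_le' hsub tendsto_const_nhds ?_ ?_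
      · filter_upwards [eventually_gt_atTop 0] with n hn
        rw [tsub_le_iff_right, ← hcell]
        exact (hk n hn).2.1
      · filter_upwards [eventually_gt_atTop 0] with n hn using (hk n hn).1.le
    · filter_upwards [eventually_gt_atTop 0] with n hn using (hk n hn).1
  have hB : Tendsto (fun n => ((k n + 1 : ℕ) : ℝ≥0) / n) atTop (𝓝[≥] t) := by
    refine tendsto_nhdsWithin_iff.2 ⟨?_, ?_⟩
    · simp_rw [hcell]
      simpa using (hA.mono_right nhdsWithin_le_nhds).add hinv
    · filter_upwards [eventually_gt_atTop 0] with n hn using (hk n hn).2.1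
  have hfA : Tendsto (fun n => f ((k n : ℝ≥0) / n)) atTop (𝓝 l) := hl.comp hA
  have hfB : Tendsto (fun n => f (((k n + 1 : ℕ) : ℝ≥0) / n)) atTop (𝓝 (f t)) :=
    Tendsto.comp hright hB
  rw [pathJump, hleft] at hjump
  rw [hleft]
  filter_upwards [eventually_gt_atTop 0, (hfB.sub hfA).abs.eventually (lt_mem_nhds hjump),
    hfA.eventually (Metric.closedBall_mem_nhds l hδ),
    hfB.eventually (Metric.closedBall_mem_nhds (f t) hδ)] with n hn h1 h2 h3
  exact ⟨k n, (hk n hn).2.2, h1, h2, h3⟩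

end IsCadlagPath

/-! ### Probability estimates for increments on a grid -/

namespace IsLevyProcess

variable {Ω : Type*} [MeasurableSpace Ω] {P : Measure Ω} {X : ℝ≥0 → Ω → ℝ}

lemma measure_increment (hX : IsLevyProcess X P) (s h : ℝ≥0) {B : Set ℝ} (hB : MeasurableSet B) :
    P {ω | X (s + h) ω - X s ω ∈ B} = P {ω | X h ω ∈ B} := by
  have := congrArg (fun ν => ν B) (hX.stationary_increments s h)
  have hmeas : Measurable fun ω => X (s + h) ω - X s ω := (hX.measurable _).sub (hX.measurable _)
  rwa [Measure.map_apply hmeas hB, Measure.map_apply (hX.measurable h) hB] at this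

variable [IsProbabilityMeasure P]

/-- The concentration of `X t` does not increase with `t`. -/
lemma measure_closedBall_le (hX : IsLevyProcess X P) {s t : ℝ≥0} (hst : s ≤ t) {δ : ℝ}
    {q : ENNReal} (hq : ∀ y, P {ω | X s ω ∈ Metric.closedBall y δ} ≤ q) (y : ℝ) :
    P {ω | X t ω ∈ Metric.closedBall y δ} ≤ q := by
  have hind : IndepFun (X s) (fun ω => X t ω - X s ω) P :=
    hX.indep_increments.indepFun_eval_sub zero_le hst hX.start_zero
  have := measure_indep_section_le (hX.measurable s) ((hX.measurable t).sub (hX.measurable s)) hind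
    (S := {p | p.1 + p.2 ∈ Metric.closedBall y δ})
    (Metric.isClosed_closedBall.measurableSet.preimage (by fun_prop)) MeasurableSet.univ (q := q)
    (fun z => (measure_mono fun ω hω => by
      simp only [mem_ofPred_eq, Metric.mem_closedBall, Real.dist_eq] at hω ⊢
      rwa [← sub_add, add_sub_right_comm] at *).trans (hq (y - z)))
  simpa using this

/-- The probability that an increment over a time step `1 / n` exceeds `ε` is `O(1 / n)`, along
the multiples `n` of a suitable integer. -/
lemma exists_measure_step_le (hX : IsLevyProcess X P) {ε : ℝ} (hε : 0 < ε) :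
    ∃ M : ℕ, 0 < M ∧ ∀ m : ℕ, 0 < m →
      ((M * m : ℕ) : ℝ) * P.real {ω | ε < |X (1 / (M * m : ℕ)) ω|} ≤ M := by
  -- Right-continuity at `0` makes these events exhaust almost all of `Ω`, so some `C M` has
  -- probability above `1/2`.
  let C : ℕ → Set Ω := fun M =>
    {ω | ∀ a b : ℕ, (a : ℝ≥0) / b ≤ 1 / ((M : ℝ≥0) + 1) → |X (a / b) ω| ≤ ε / 2}
  have hCmono : Monotone C := fun M N hMN ω hω a b hab =>
    hω a b (hab.trans (by gcongr))
  have hCuniv : P (⋃ M, C M) = 1 := by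
    refine (measure_congr (eventuallyEq_univ.2 ?_)).trans measure_univ
    filter_upwards [hX.start_zero, hX.cadlag] with ω h0 hω
    have hr := (hω 0).1
    rw [show Ici (0 : ℝ≥0) = univ from Ici_bot, continuousWithinAt_univ] at hr
    have hev : ∀ᶠ s : ℝ≥0 in 𝓝 0, |X s ω| < ε / 2 := by
      refine hr.abs.eventually_lt_const ?_
      simp only [h0, abs_zero]
      positivity
    obtain ⟨r, hr0, hr⟩ := NNReal.nhds_zero_basis.eventually_iff.1 hev
    obtain ⟨M, hM⟩ := exists_nat_one_div_lt hr0
    exact mem_iUnion.2 ⟨M, fun a b hab => (hr (hab.trans_lt hM)).le⟩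
  have hlim := tendsto_measure_iUnion_atTop (μ := P) hCmono
  rw [hCuniv] at hlim
  obtain ⟨M, hM⟩ := (hlim.eventually (lt_mem_nhds
    (show (1 / 2 : ENNReal) < 1 from ENNReal.half_lt_self one_ne_zero ENNReal.one_ne_top))).exists
  refine ⟨M + 1, M.succ_pos, fun m hm => ?_⟩
  set n := (M + 1) * m with hn
  have hn0 : (0 : ℝ≥0) < n := by
    have : 0 < n := by positivity
    exact_mod_cast this
  set p := P.real {ω | ε < |X (1 / (n : ℕ)) ω|} with hp
  let τ : ℕ → ℝ≥0 := fun i => (i : ℝ≥0) / n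
  have hτ : Monotone τ := fun i j hij => by simp only [τ]; gcongr
  have hτs : ∀ i, τ (i + 1) = τ i + 1 / n := fun i => by
    simp only [τ, Nat.cast_succ, add_div]
  let B : Set ℝ := {y | |y| ≤ ε}
  have hB : MeasurableSet B := (isClosed_le (by fun_prop) (by fun_prop)).measurableSet
  have hstep : P.real {ω | X (1 / (n : ℕ)) ω ∈ B} = 1 - p := by
    rw [hp, ← probReal_compl_eq_one_sub]
    · congr 1
      ext ω
      simp [B]
    · exact measurableSet_lt measurable_const (hX.measurable _).abs
  have hprod : P (⋂ i ∈ Finset.range m, (fun ω => X (τ (i + 1)) ω - X (τ i) ω) ⁻¹' B)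
      = P {ω | X (1 / (n : ℕ)) ω ∈ B} ^ m := by
    rw [(hX.indep_increments.nat hτ).measure_inter_preimage_eq_mul (Finset.range m)
      (fun _ _ => hB), ← Finset.card_range m, ← Finset.prod_const, Finset.card_range]
    refine Finset.prod_congr rfl fun i _ => ?_
    rw [hτs]
    exact hX.measure_increment _ _ hB
  -- The `m` steps of length `1/n` exactly fill `[0, 1/(M+1)]`, so on `C M` none of them exceeds
  -- `ε`.
  have hsub : C M ⊆ ⋂ i ∈ Finset.range m, (fun ω => X (τ (i + 1)) ω - X (τ i) ω) ⁻¹' B := by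
    intro ω hω
    have hle : ∀ i ≤ m, |X (τ i) ω| ≤ ε / 2 := fun i hi => by
      refine hω i n ?_
      rw [div_le_div_iff₀ hn0 (by positivity), hn]
      push_cast
      have : (i : ℝ≥0) ≤ m := by exact_mod_cast hi
      calc (i : ℝ≥0) * (M + 1) ≤ m * (M + 1) := by gcongr
        _ = 1 * ((M + 1) * m) := by ring
    refine mem_iInter₂.2 fun i hi => ?_
    have hi := Finset.mem_range.1 hi
    have h1 := hle (i + 1) hi
    have h2 := hle i hi.le
    have h3 := abs_sub (X (τ (i + 1)) ω) (X (τ i) ω)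
    simp only [B, mem_preimage, mem_ofPred_eq]
    linarith
  have hhalf : 1 / 2 ≤ (1 - p) ^ m := by
    have h1 : (1 / 2 : ENNReal) ≤ P {ω | X (1 / (n : ℕ)) ω ∈ B} ^ m :=
      hprod ▸ hM.le.trans (measure_mono hsub)
    have h2 := ENNReal.toReal_mono (ENNReal.pow_ne_top (measure_ne_top _ _)) h1
    rw [ENNReal.toReal_pow, ← measureReal_def, hstep] at h2
    simpa using h2
  have hp0 : 0 ≤ p := measureReal_nonneg
  have hp1 : p ≤ 1 := measureReal_le_one
  -- Multiplying by `(1 + p)^m` gives `(1 + mp)/2 ≤ (1 - p²)^m ≤ 1`, hence `mp ≤ 1`.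
  have hbern : 1 + m * p ≤ (1 + p) ^ m := one_add_mul_le_pow (by linarith) m
  have hone : (1 - p) ^ m * (1 + p) ^ m ≤ 1 := by
    rw [← mul_pow]
    exact pow_le_one₀ (by nlinarith) (by nlinarith)
  have hmp : m * p ≤ 1 := by
    have h1 : 1 / 2 * (1 + m * p) ≤ (1 - p) ^ m * (1 + p) ^ m :=
      mul_le_mul hhalf hbern (by positivity) (by positivity)
    linarith
  have : (n : ℝ) * p = (M + 1) * (m * p) := by rw [hn]; push_cast; ring
  rw [this]
  push_cast
  exact mul_le_of_le_one_right (by positivity) hmp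

/-- Almost surely, it does not happen that every fine grid has a cell with increment `I` larger
than `ε` whose left value `y` satisfies `y + θ I ≈ x`. -/
lemma ae_not_eventually_grid_cell (hX : IsLevyProcess X P)
    (hatom : ∀ t : ℝ≥0, 0 < t → ∀ y : ℝ, P {ω | X t ω = y} = 0) (x θ : ℝ) {ε : ℝ} (hε : 0 < ε) :
    ∀ᵐ ω ∂P, ¬ ∀ δ > 0, ∀ᶠ n : ℕ in atTop, ∃ k < n,
      ε < |X (((k + 1 : ℕ) : ℝ≥0) / n) ω - X ((k : ℝ≥0) / n) ω| ∧
      |X ((k : ℝ≥0) / n) ω + θ * (X (((k + 1 : ℕ) : ℝ≥0) / n) ω - X ((k : ℝ≥0) / n) ω) - x|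
        ≤ δ := by
  obtain ⟨M, hM0, hM⟩ := hX.exists_measure_step_le hε
  simp only [ae_iff, not_not]
  set A : Set Ω := {ω | ∀ δ > 0, ∀ᶠ n : ℕ in atTop, ∃ k < n,
      ε < |X (((k + 1 : ℕ) : ℝ≥0) / n) ω - X ((k : ℝ≥0) / n) ω| ∧
      |X ((k : ℝ≥0) / n) ω + θ * (X (((k + 1 : ℕ) : ℝ≥0) / n) ω - X ((k : ℝ≥0) / n) ω) - x|
        ≤ δ} with hA
  have key : ∀ L : ℕ, 0 < L → P A ≤ ENNReal.ofReal (2 * M * (1 / L)) := by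
    intro L hL
    have hL' : (0 : ℝ≥0) < 1 / (L : ℝ≥0) := by positivity
    have hmap : ∀ y, (P.map (X (1 / L))) {y} = 0 := fun y => by
      rw [Measure.map_apply (hX.measurable _) (measurableSet_singleton y)]
      exact hatom _ hL' y
    have := Measure.isProbabilityMeasure_map (μ := P) (hX.measurable (1 / L)).aemeasurable
    obtain ⟨δ, hδ, hball⟩ := exists_closedBall_measure_le _ hmap hL'
    have hconc : ∀ t : ℝ≥0, 1 / (L : ℝ≥0) ≤ t → ∀ y,
        P {ω | X t ω ∈ Metric.closedBall y δ} ≤ ((1 / (L : ℝ≥0) : ℝ≥0) : ENNReal) :=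
      fun t ht => hX.measure_closedBall_le ht fun y => by
        have := hball y
        rwa [Measure.map_apply (hX.measurable _) Metric.isClosed_closedBall.measurableSet] at this
    -- Divisible by `M` for the step bound, and by `L` so that exactly `M(j+1) = N j / L` cells
    -- start before `1/L`.
    let N : ℕ → ℕ := fun j => M * (L * (j + 1))
    let F : ℕ → ℕ → Set Ω := fun n k =>
      {ω | |X ((k : ℝ≥0) / n) ω + θ * (X (((k + 1 : ℕ) : ℝ≥0) / n) ω - X ((k : ℝ≥0) / n) ω) - x|
        ≤ δ ∧ ε < |X (((k + 1 : ℕ) : ℝ≥0) / n) ω - X ((k : ℝ≥0) / n) ω|}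
    let p : ℕ → ℝ := fun n => P.real {ω | ε < |X (1 / n) ω|}
    let J : Set ℝ := {z | ε < |z|}
    have hJ : MeasurableSet J := (isOpen_lt (by fun_prop) (by fun_prop)).measurableSet
    have hpJ : ∀ n k : ℕ, P {ω | X (((k + 1 : ℕ) : ℝ≥0) / n) ω - X ((k : ℝ≥0) / n) ω ∈ J}
        = ENNReal.ofReal (p n) := fun n k => by
      rw [ofReal_measureReal]
      simp only [Nat.cast_succ, add_div]
      exact hX.measure_increment _ _ hJ
    have hFtriv : ∀ n k : ℕ, P (F n k) ≤ ENNReal.ofReal (p n) := fun n k => by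
      rw [← hpJ n k]
      exact measure_mono fun ω hω => hω.2
    have hFconc : ∀ n k : ℕ, 1 / (L : ℝ≥0) ≤ (k : ℝ≥0) / n →
        P (F n k) ≤ ENNReal.ofReal (p n * (1 / L)) := fun n k hk => by
      have hle : (k : ℝ≥0) / n ≤ ((k + 1 : ℕ) : ℝ≥0) / n := by gcongr; omega
      have := measure_indep_section_le (hX.measurable _)
        ((hX.measurable _).sub (hX.measurable _))
        (hX.indep_increments.indepFun_eval_sub zero_le hle hX.start_zero)
        (S := {r | |r.1 + θ * r.2 - x| ≤ δ})
        (isClosed_le (by fun_prop) (by fun_prop)).measurableSet hJ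
        (q := ((1 / (L : ℝ≥0) : ℝ≥0) : ENNReal))
        (fun z => (measure_mono fun ω hω => by
          simp only [mem_ofPred_eq, Metric.mem_closedBall, Real.dist_eq] at hω ⊢
          rwa [← sub_add, add_sub_right_comm] at *).trans (hconc _ hk (x - θ * z)))
      refine this.trans_eq ?_
      erw [hpJ n k]
      rw [mul_comm, ENNReal.ofReal_mul measureReal_nonneg]
      congr 1
      rw [← ENNReal.ofReal_coe_nnreal]
      simp
    let E : ℕ → Set Ω := fun j => ⋃ k ∈ Finset.range (N j), F (N j) k
    -- The early cells cost `p` each and the others `p/L` each, so each group contributes at most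
    -- `Np/L ≤ M/L`.
    have hE : ∀ j, P (E j) ≤ ENNReal.ofReal (2 * M * (1 / L)) := by
      intro j
      have hNpos : (0 : ℝ≥0) < N j := by
        have : 0 < N j := by positivity
        exact_mod_cast this
      have hsmall : M * (j + 1) ≤ N j := by
        simp only [N]; gcongr; exact Nat.le_mul_of_pos_left _ hL
      have hNL : ((M * (j + 1) : ℕ) : ℝ) = N j * (1 / L) := by
        simp only [N]; push_cast; field_simp
      have hbound : ∀ k ∈ Finset.range (N j), P (F (N j) k) ≤
          ENNReal.ofReal ((if k < M * (j + 1) then p (N j) else 0) + p (N j) * (1 / L)) := by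
        intro k _
        have hp0 : 0 ≤ p (N j) := measureReal_nonneg
        split_ifs with hk
        · exact (hFtriv _ _).trans (ENNReal.ofReal_le_ofReal (le_add_of_nonneg_right (by positivity)))
        · rw [zero_add]
          refine hFconc _ _ ?_
          rw [div_le_div_iff₀ (by positivity) hNpos, one_mul]
          have : N j ≤ k * L := by
            calc N j = M * (j + 1) * L := by simp only [N]; ring
              _ ≤ k * L := Nat.mul_le_mul_right _ (not_lt.1 hk)
          exact_mod_cast this
      have hp0 : 0 ≤ p (N j) := measureReal_nonneg
      calc P (E j) ≤ ∑ k ∈ Finset.range (N j), P (F (N j) k) := measure_biUnion_finset_le _ _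
        _ ≤ ∑ k ∈ Finset.range (N j), ENNReal.ofReal
            ((if k < M * (j + 1) then p (N j) else 0) + p (N j) * (1 / L)) :=
            Finset.sum_le_sum hbound
        _ = ENNReal.ofReal (∑ k ∈ Finset.range (N j),
            ((if k < M * (j + 1) then p (N j) else 0) + p (N j) * (1 / L))) := by
            rw [ENNReal.ofReal_sum_of_nonneg]
            intro k _
            split_ifs <;> positivity
        _ = ENNReal.ofReal (2 * (N j * p (N j)) * (1 / L)) := by
            congr 1
            rw [Finset.sum_add_distrib, ← Finset.sum_filter,
              show (Finset.range (N j)).filter (· < M * (j + 1)) = Finset.range (M * (j + 1)) by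
                ext k; simp only [Finset.mem_filter, Finset.mem_range]; omega]
            simp only [Finset.sum_const, Finset.card_range, nsmul_eq_mul, hNL]
            ring
        _ ≤ ENNReal.ofReal (2 * M * (1 / L)) := by
            have := hM (L * (j + 1)) (by positivity)
            refine ENNReal.ofReal_le_ofReal ?_
            gcongr
    have hN : Tendsto N atTop atTop := tendsto_atTop_mono (fun j => by
      have : 0 < M * L := by positivity
      calc j ≤ 1 * (j + 1) := by omega
        _ ≤ M * L * (j + 1) := by gcongr; exact this
        _ = N j := by simp only [N]; ring) tendsto_id
    -- `A` lies in the lower limit of the `E j`, an increasing union of sets each contained in some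
    -- `E i`, so the uniform bound passes to `A`.
    have hAsub : A ⊆ ⋃ i, ⋂ j ≥ i, E j := fun ω hω => by
      obtain ⟨i, hi⟩ := eventually_atTop.1 (hN.eventually (hω δ hδ))
      refine mem_iUnion.2 ⟨i, mem_iInter₂.2 fun j hj => ?_⟩
      obtain ⟨k, hk, h1, h2⟩ := hi j hj
      exact mem_iUnion₂.2 ⟨k, Finset.mem_range.2 hk, h2, h1⟩
    have hmono : Monotone fun i => ⋂ j ≥ i, E j := fun a b hab =>
      biInter_mono (fun j hj => hab.trans hj) fun _ _ => subset_rfl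
    refine (measure_mono hAsub).trans ?_
    rw [hmono.measure_iUnion]
    exact iSup_le fun i => (measure_mono (biInter_subset_of_mem (le_refl i))).trans (hE i)
  have hlim : Tendsto (fun L : ℕ => ENNReal.ofReal (2 * M * (1 / L))) atTop (𝓝 0) := by
    have : Tendsto (fun L : ℕ => 2 * (M : ℝ) * (1 / L)) atTop (𝓝 0) := by
      simpa using tendsto_one_div_atTop_nhds_zero_nat.const_mul (2 * (M : ℝ))
    simpa using ENNReal.tendsto_ofReal this
  refine nonpos_iff_eq_zero.1 (ge_of_tendsto hlim ?_)
  filter_upwards [eventually_gt_atTop 0] with L hL using key L hL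

end IsLevyProcess

theorem lemma4p2 {Ω : Type*} [MeasurableSpace Ω] (P : Measure Ω) [IsProbabilityMeasure P]
    (X : ℝ≥0 → Ω → ℝ) (hX : IsLevyProcess X P)
    (hatom : ∀ t : ℝ≥0, 0 < t → ∀ y : ℝ, P {ω | X t ω = y} = 0) (x : ℝ) :
    (∀ᵐ ω ∂P, {t : ℝ≥0 | t ∈ Icc 0 1 ∧ pathJump (fun s => X s ω) t ≠ 0 ∧
      pathLeftLim (fun s => X s ω) t = x} = ∅) ∧
    (∀ᵐ ω ∂P, {t : ℝ≥0 | t ∈ Icc 0 1 ∧ pathJump (fun s => X s ω) t ≠ 0 ∧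
      X t ω = x} = ∅) := by
  -- `θ = 0` tests the left end value against `X_{t-}`, `θ = 1` the right one against `X_t`; the
  -- thresholds `1/(i+1)` catch every nonzero jump.
  have hgrid : ∀ θ : ℝ, ∀ᵐ ω ∂P, ∀ i : ℕ, _ := fun θ => ae_all_iff.2 fun i : ℕ =>
    hX.ae_not_eventually_grid_cell hatom x θ (Nat.one_div_pos_of_nat (n := i))
  constructor
  · filter_upwards [hX.cadlag, hgrid 0] with ω hω hg
    refine eq_empty_of_forall_notMem fun t ⟨ht, hjump, hx⟩ => ?_
    obtain ⟨i, hi⟩ := exists_nat_one_div_lt (abs_pos.2 hjump)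
    refine hg i fun δ hδ => ?_
    filter_upwards [hω.eventually_exists_grid_cell ht.2 Nat.one_div_pos_of_nat hδ hi]
      with n ⟨k, hk, h1, h2, _⟩
    refine ⟨k, hk, h1, ?_⟩
    rwa [zero_mul, add_zero, ← hx]
  · filter_upwards [hX.cadlag, hgrid 1] with ω hω hg
    refine eq_empty_of_forall_notMem fun t ⟨ht, hjump, hx⟩ => ?_
    obtain ⟨i, hi⟩ := exists_nat_one_div_lt (abs_pos.2 hjump)
    refine hg i fun δ hδ => ?_
    filter_upwards [hω.eventually_exists_grid_cell ht.2 Nat.one_div_pos_of_nat hδ hi]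
      with n ⟨k, hk, h1, _, h3⟩
    refine ⟨k, hk, h1, ?_⟩
    rwa [one_mul, add_sub_cancel, ← hx]
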